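/- **Conventions.** For a partial order $M$, let $M^D$ be its Dedekind–MacNeille completion, i.e. the set of all $J\subseteq M$ that are nonempty, bounded above and equal to the set of lower bounds of their set of upper bounds, ordered by inclusion; identify $x\in M$ with $\{y : y\le x\}$. A *connecting set* from $a\in M$ to $b\in M$ is a tuple $c_1=a,c_2,\dots,c_n=b$ ($n\ge 2$) in $M^D$ whose consecutive terms are comparable and such that each interior $c_i$ is strictly above both, or strictly below both, of $c_{i-1},c_{i+1}$. A *path* from $a$ to $b$ is a union $\sigma_1\cup\dots\cup\sigma_{n-1}$, where $c_1,\dots,c_n$ is a connecting set from $a$ to $b$ (its terms are the *turning points* of the path), $\sigma_k\subseteq M^D$ is a maximal chain with endpoints $c_k,c_{k+1}$, and $x\in\sigma_i\cap\sigma_j$ with $i<j$ implies $j=i+1$ and $x=c_{i+1}$. $M$ is a *cycle-free partial order* (CFPO) if there is at most one path between any two points of $M$, and *connected* if there is at least one. Partial orders may carry an arbitrary family of unary colour predicates, and automorphisms preserve the order and all colours. A *coloured tree* is a partial order with unary predicates in which the elements below any given element are linearly ordered and any two elements have a common lower bound. Two permutation groups are *isomorphic as permutation groups* if there are a group isomorphism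 and a bijection of the underlying sets that respect the actions. **Theorem.** Let $M$ be a connected (possibly coloured) CFPO and let $r\in M$ be fixed by every automorphism of $M$. Assume that all turning points of paths in $M$ that start at $r$ belong to $M$ (this holds for instance if $M=M^D$). Define on the set $M$ the relation $s\le_T t$ if and only if $s$ lies on the path from $r$ to $t$. Put $X_0=\{t: r\le t\}$, $Y_0=\{t : t<r\}$ and, for $n\ge 1$, $$X_n=\{t : y\le t\text{ for some }y\in Y_{n-1}\}\setminus\bigcup_{i<n}(X_i\cup Y_i),\qquad Y_n=\{t : t<x\text{ for some }x\in X_{n-1}\}\setminus\bigcup_{i<n}(X_i\cup Y_i),$$ and let $U$ be the unary predicate that holds exactly on $X=\bigcup_n X_n$. Let $T(M)$ be the set $M$ with the relation $\le_T$, the colours of $M$, and the additional predicate $U$. Then $T(M)$ is a coloured tree, and $\mathrm{Aut}(M)$ and $\mathrm{Aut}(T(M))$ are isomorphic as permutation groups. -/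

import Mathlib

open Set

/-- The Dedekind–MacNeille completion `M^D` used for cycle-free partial orders: the cuts
`(L, R)` of `M` with `L` nonempty and bounded above, that is with both halves nonempty.  (No new
least or greatest element is added.) -/
def MDCompletion (M : Type*) [PartialOrder M] : Type _ :=
  {A : DedekindCut M // A.left.Nonempty ∧ A.right.Nonempty}

instance MDCompletion.instPartialOrder (M : Type*) [PartialOrder M] :
    PartialOrder (MDCompletion M) :=
  inferInstanceAs
    (PartialOrder {A : DedekindCut M // A.left.Nonempty ∧ A.right.Nonempty})

/-- The canonical embedding of `M` in `M^D`. -/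
def toMD {M : Type*} [PartialOrder M] (x : M) : MDCompletion M :=
  ⟨DedekindCut.principal x, ⟨x, self_mem_Iic⟩, ⟨x, self_mem_Ici⟩⟩

theorem toMD_le_toMD {M : Type*} [PartialOrder M] {x y : M} :
    toMD x ≤ toMD y ↔ x ≤ y :=
  DedekindCut.principal_le_principal

/-- `c 0, c 1, …, c n` is a connecting set from `a` to `b` (an `(n+1)`-tuple, `n ≥ 1`):
consecutive terms are comparable, and every interior term is strictly above both of its
neighbours or strictly below both of them. -/
structure IsConnectingSet {M : Type*} [PartialOrder M] (a b : M) (n : ℕ)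
    (c : Fin (n + 1) → MDCompletion M) : Prop where
  one_le : 1 ≤ n
  first : c 0 = toMD a
  last : c (Fin.last n) = toMD b
  comparable : ∀ k : Fin n, c k.castSucc ≤ c k.succ ∨ c k.succ ≤ c k.castSucc
  alternating : ∀ i j : Fin n, (j : ℕ) = i + 1 →
    (c i.castSucc < c i.succ ∧ c j.succ < c i.succ) ∨
      (c i.succ < c i.castSucc ∧ c i.succ < c j.succ)

/-- `S` is a maximal chain of `P` among the chains with endpoints `u` and `v`. -/
def IsMaxChainBetween {P : Type*} [PartialOrder P] (u v : P) (S : Set P) : Prop :=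
  Maximal (fun s : Set P => IsChain (· ≤ ·) s ∧ u ∈ s ∧ v ∈ s ∧ s ⊆ Icc u v ∪ Icc v u) S

/-- `P` is a path from `a` to `b` in `M`, with connecting set `c 0, …, c n`: it is the union of
maximal chains `σ k` with endpoints `c k` and `c (k+1)`, where two of these chains meet only if
they are consecutive, and then only in their common endpoint. -/
def IsPathVia {M : Type*} [PartialOrder M] (a b : M) (n : ℕ)
    (c : Fin (n + 1) → MDCompletion M) (P : Set (MDCompletion M)) : Prop :=
  IsConnectingSet a b n c ∧
    ∃ σ : Fin n → Set (MDCompletion M),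
      (∀ k, IsMaxChainBetween (c k.castSucc) (c k.succ) (σ k)) ∧
      (∀ i j : Fin n, i < j → ∀ x ∈ σ i ∩ σ j, (j : ℕ) = i + 1 ∧ x = c i.succ) ∧
      P = ⋃ k, σ k

/-- `P ⊆ M^D` is a path from `a` to `b` in `M`. -/
def IsPath {M : Type*} [PartialOrder M] (a b : M) (P : Set (MDCompletion M)) : Prop :=
  ∃ (n : ℕ) (c : Fin (n + 1) → MDCompletion M), IsPathVia a b n c P

/-- `M` is a cycle-free partial order: between any two points there is at most one path. -/
def IsCFPO (M : Type*) [PartialOrder M] : Prop :=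
  ∀ (x y : M) (P Q : Set (MDCompletion M)), IsPath x y P → IsPath x y Q → P = Q

/-- `M` is connected: between any two points there is a path. -/
def IsPathConnectedOrder (M : Type*) [PartialOrder M] : Prop :=
  ∀ x y : M, ∃ P : Set (MDCompletion M), IsPath x y P

/-- Every path in `M` that starts at `r` has all its turning points (the terms of its connecting
set) in `M`, rather than merely in `M^D`. -/
def TurningPointsIn {M : Type*} [PartialOrder M] (r : M) : Prop :=
  ∀ (t : M) (n : ℕ) (c : Fin (n + 1) → MDCompletion M) (P : Set (MDCompletion M)),
    IsPathVia r t n c P → ∀ k, c k ∈ range (toMD : M → MDCompletion M)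

/-- A set with a binary relation and a family of unary (colour) predicates. -/
structure ColouredRel (α ι : Type*) where
  le : α → α → Prop
  colour : ι → Set α

/-- The automorphism group, as a group of permutations of the underlying set. -/
def ColouredRel.Aut {α ι : Type*} (S : ColouredRel α ι) : Subgroup (Equiv.Perm α) where
  carrier := {g | (∀ x y, S.le (g x) (g y) ↔ S.le x y) ∧ ∀ i x, g x ∈ S.colour i ↔ x ∈ S.colour i}
  one_mem' := ⟨fun _ _ => Iff.rfl, fun _ _ => Iff.rfl⟩
  mul_mem' := fun {g h} hg hh =>
    ⟨fun x y => (hg.1 (h x) (h y)).trans (hh.1 x y),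
      fun i x => (hg.2 i (h x)).trans (hh.2 i x)⟩
  inv_mem' := fun {g} hg =>
    ⟨fun x y => by simpa using (hg.1 (g⁻¹ x) (g⁻¹ y)).symm,
      fun i x => by simpa using (hg.2 i (g⁻¹ x)).symm⟩

/-- A coloured tree: a partial order with arbitrary unary predicates in which the elements below
a given one are linearly ordered and any two elements have a common lower bound. -/
structure ColouredRel.IsTree {α ι : Type*} (S : ColouredRel α ι) : Prop where
  refl : ∀ x, S.le x x
  trans : ∀ x y z, S.le x y → S.le y z → S.le x z
  antisymm : ∀ x y, S.le x y → S.le y x → x = y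
  linear_below : ∀ t x y, S.le x t → S.le y t → S.le x y ∨ S.le y x
  common_lower_bound : ∀ x y, ∃ z, S.le z x ∧ S.le z y

/-- Isomorphism of permutation groups: a group isomorphism together with a bijection of the
underlying sets that is compatible with the actions. -/
def PermGroupIso {α β : Type*} (G : Subgroup (Equiv.Perm α)) (H : Subgroup (Equiv.Perm β)) :
    Prop :=
  ∃ (φ : G ≃* H) (e : α ≃ β), ∀ (g : G) (a : α),
    e ((g : Equiv.Perm α) a) = (φ g : Equiv.Perm β) (e a)

/-- The triple `(X_n, Y_n, ⋃ i ≤ n, X_i ∪ Y_i)`. -/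
def layerData {M : Type*} [PartialOrder M] (r : M) : ℕ → Set M × Set M × Set M
  | 0 => ({t | r ≤ t}, {t | t < r}, {t | r ≤ t} ∪ {t | t < r})
  | n + 1 =>
    let X := {t | ∃ y ∈ (layerData r n).2.1, y ≤ t} \ (layerData r n).2.2
    let Y := {t | ∃ x ∈ (layerData r n).1, t < x} \ (layerData r n).2.2
    (X, Y, (layerData r n).2.2 ∪ (X ∪ Y))

/-- The upward layer `X_n`. -/
def layerX {M : Type*} [PartialOrder M] (r : M) (n : ℕ) : Set M := (layerData r n).1

/-- The downward layer `Y_n`. -/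
def layerY {M : Type*} [PartialOrder M] (r : M) (n : ℕ) : Set M := (layerData r n).2.1

theorem layerData_union {M : Type*} [PartialOrder M] (r : M) (n : ℕ) :
    (layerData r n).2.2 = ⋃ i < n + 1, layerX r i ∪ layerY r i := by
  induction n with
  | zero => simp [layerData, layerX, layerY]
  | succ n ih =>
    rw [biUnion_lt_succ, ← ih]
    rfl

theorem layerX_zero {M : Type*} [PartialOrder M] (r : M) : layerX r 0 = {t | r ≤ t} := rfl

theorem layerY_zero {M : Type*} [PartialOrder M] (r : M) : layerY r 0 = {t | t < r} := rfl

theorem layerX_succ {M : Type*} [PartialOrder M] (r : M) (n : ℕ) :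
    layerX r (n + 1) =
      {t | ∃ y ∈ layerY r n, y ≤ t} \ ⋃ i < n + 1, layerX r i ∪ layerY r i := by
  rw [← layerData_union]
  rfl

theorem layerY_succ {M : Type*} [PartialOrder M] (r : M) (n : ℕ) :
    layerY r (n + 1) =
      {t | ∃ x ∈ layerX r n, t < x} \ ⋃ i < n + 1, layerX r i ∪ layerY r i := by
  rw [← layerData_union]
  rfl

/-- The coloured structure `(M, ≤, C)` itself. -/
def colouredOrder {M ι : Type*} [PartialOrder M] (C : ι → Set M) : ColouredRel M ι where
  le := (· ≤ ·)
  colour := C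

/-- The structure `T(M)` on the set `M`: `s` is below `t` if `s` lies on the path from `r` to `t`;
the colours are those of `M` (indexed by `some i`) and the new predicate `U` (indexed by `none`),
which holds exactly on the union of the layers `X_n`. -/
def treeOf {M ι : Type*} [PartialOrder M] (C : ι → Set M) (r : M) :
    ColouredRel M (Option ι) where
  le s t := ∃ P, IsPath r t P ∧ toMD s ∈ P
  colour
    | none => ⋃ n, layerX r n
    | some i => C i

/-! The two automorphism groups are the same subgroup of the permutations of `M`, because each
structure is definable from the other once `r` is fixed.

The tool is a first-hit argument. `M^D` is conditionally complete, so a path from `r` that meets an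
interval has a first point `p` in it (`RootPath.first_hit`). The path stopped at `p` can be
continued inside the interval to any point comparable with `p`, and the new piece meets the old one
only in `p` (`RootPath.extend`). Comparing such paths with the unique path to a point of `M` shows
that initial segments are unique, which makes `T(M)` a tree, and that the endpoint determines the
number of links and, if it is not `r`, the direction of the last link (`level_unique`). So each
point other than `r` is reached either upwards or downwards, and `U` marks those reached upwards,
together with `r` (`mem_layerOf_iff`).

The order is recovered by `le_iff`: `s ≤ t` exactly when some `z` on both root paths is such that
all points of `M` after `z` towards `s` are reached downwards and all those after `z` towards `t`
upwards. Conversely, an automorphism of `M` acts on `M^D`, fixes `r`, and carries root paths to root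
paths with the same directions. -/

theorem isMaxChainBetween_comm {P : Type*} [PartialOrder P] {u v : P} {S : Set P} :
    IsMaxChainBetween u v S ↔ IsMaxChainBetween v u S := by
  have : ∀ {u v : P}, IsMaxChainBetween u v S → IsMaxChainBetween v u S := by
    intro u v h
    refine ⟨⟨h.prop.1, h.prop.2.2.1, h.prop.2.1, by rw [union_comm]; exact h.prop.2.2.2⟩, ?_⟩
    rintro T ⟨h1, h2, h3, h4⟩ hST
    exact h.2 ⟨h1, h3, h2, by rw [union_comm]; exact h4⟩ hST
  exact ⟨this, this⟩

theorem isMaxChainBetween_toDual {P : Type*} [PartialOrder P] {u v : P} {S : Set P} :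
    IsMaxChainBetween (P := Pᵒᵈ) (OrderDual.toDual u) (OrderDual.toDual v)
      (OrderDual.ofDual ⁻¹' S) ↔ IsMaxChainBetween u v S := by
  have key : ∀ T : Set P, (IsChain (α := Pᵒᵈ) (· ≤ ·) (OrderDual.ofDual ⁻¹' T) ∧
      OrderDual.toDual u ∈ OrderDual.ofDual ⁻¹' T ∧ OrderDual.toDual v ∈ OrderDual.ofDual ⁻¹' T ∧
      OrderDual.ofDual ⁻¹' T ⊆
        Icc (OrderDual.toDual u) (OrderDual.toDual v) ∪
          Icc (OrderDual.toDual v) (OrderDual.toDual u)) ↔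
      (IsChain (· ≤ ·) T ∧ u ∈ T ∧ v ∈ T ∧ T ⊆ Icc u v ∪ Icc v u) := by
    intro T
    constructor
    · rintro ⟨h1, h2, h3, h4⟩
      exact ⟨fun x hx y hy hne => (h1 hx hy hne).symm, h2, h3,
        fun x hx => (h4 hx).symm.imp And.symm And.symm⟩
    · rintro ⟨h1, h2, h3, h4⟩
      exact ⟨fun x hx y hy hne => (h1 hx hy hne).symm, h2, h3,
        fun x hx => (h4 hx).symm.imp And.symm And.symm⟩
  constructor
  · intro h
    exact ⟨(key S).1 h.1, fun T hT hST => h.2 ((key T).2 hT) hST⟩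
  · intro h
    exact ⟨(key S).2 h.1, fun T hT hST => h.2 ((key (OrderDual.toDual ⁻¹' T)).1 hT) hST⟩

/-! ### Maximal chains with given endpoints -/

section Chains

variable {P : Type*} [PartialOrder P] {u v p x : P} {S T : Set P}

theorem IsMaxChainBetween.left_mem (h : IsMaxChainBetween u v S) : u ∈ S := h.1.2.1

theorem IsMaxChainBetween.right_mem (h : IsMaxChainBetween u v S) : v ∈ S := h.1.2.2.1

theorem IsMaxChainBetween.subset (h : IsMaxChainBetween u v S) : S ⊆ Icc u v ∪ Icc v u := h.1.2.2.2

theorem IsMaxChainBetween.total (h : IsMaxChainBetween u v S) {x y : P} (hx : x ∈ S)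
    (hy : y ∈ S) : x ≤ y ∨ y ≤ x := h.1.1.total hx hy

theorem IsMaxChainBetween.subset_Icc (h : IsMaxChainBetween u v S) (huv : u ≤ v) :
    S ⊆ Icc u v := by
  intro x hx
  rcases h.subset hx with h' | h'
  · exact h'
  · exact ⟨huv.trans h'.1, h'.2.trans huv⟩

theorem IsMaxChainBetween.mem_of_comparable (h : IsMaxChainBetween u v S)
    (hx : x ∈ Icc u v ∪ Icc v u) (hc : ∀ y ∈ S, x ≤ y ∨ y ≤ x) : x ∈ S := by
  have h' : insert x S ⊆ S := h.2
    ⟨h.1.1.insert fun y hy _ => hc y hy, mem_insert_of_mem _ h.left_mem,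
      mem_insert_of_mem _ h.right_mem, insert_subset hx h.subset⟩ (subset_insert _ _)
  exact h' (mem_insert _ _)

theorem isMaxChainBetween_of_le (huv : u ≤ v) (hS : IsChain (· ≤ ·) S) (hu : u ∈ S) (hv : v ∈ S)
    (hsub : S ⊆ Icc u v) (hmax : ∀ x ∈ Icc u v, (∀ y ∈ S, x ≤ y ∨ y ≤ x) → x ∈ S) :
    IsMaxChainBetween u v S := by
  refine ⟨⟨hS, hu, hv, hsub.trans subset_union_left⟩, ?_⟩
  rintro T ⟨h1, -, -, h4⟩ hST x hx
  refine hmax x ?_ fun y hy => h1.total hx (hST hy)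
  rcases h4 hx with h' | h'
  · exact h'
  · exact ⟨huv.trans h'.1, h'.2.trans huv⟩

theorem exists_isMaxChainBetween (huv : u ≤ v ∨ v ≤ u) : ∃ S, IsMaxChainBetween u v S := by
  obtain ⟨m, -, hm⟩ := zorn_subset_nonempty
    {s : Set P | IsChain (· ≤ ·) s ∧ u ∈ s ∧ v ∈ s ∧ s ⊆ Icc u v ∪ Icc v u} (by
      rintro c hcS hc ⟨s, hs⟩
      refine ⟨⋃₀ c, ⟨?_, ⟨s, hs, (hcS hs).2.1⟩, ⟨s, hs, (hcS hs).2.2.1⟩,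
        sUnion_subset fun t ht => (hcS ht).2.2.2⟩, fun s hs => subset_sUnion_of_mem hs⟩
      rintro x ⟨a, ha, hxa⟩ y ⟨b, hb, hyb⟩ hne
      rcases hc.total ha hb with hab | hab
      · exact (hcS hb).1 (hab hxa) hyb hne
      · exact (hcS ha).1 hxa (hab hyb) hne)
    {u, v} ⟨huv.elim IsChain.pair fun h => by rw [pair_comm]; exact IsChain.pair h, by simp,
      by simp, by
      rcases huv with h | h <;> rintro x (rfl | rfl) <;> simp [h]⟩
  exact ⟨m, hm⟩

/-- Intersecting with `Icc u p ∪ Icc p u` cuts out the initial segment from `u` to `p` whichever way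
the chain runs. It stays maximal because what is comparable with it and below `p` is also below the
rest of `S`. -/
theorem IsMaxChainBetween.truncate_of_le (h : IsMaxChainBetween u v S) (huv : u ≤ v)
    (hp : p ∈ S) : IsMaxChainBetween u p (S ∩ (Icc u p ∪ Icc p u)) := by
  have hS := h.subset_Icc huv
  have hup := (hS hp).1
  refine isMaxChainBetween_of_le hup (h.1.1.mono inter_subset_left)
    ⟨h.left_mem, Or.inl ⟨le_rfl, hup⟩⟩ ⟨hp, Or.inl ⟨hup, le_rfl⟩⟩ ?_ ?_
  · rintro x ⟨hx, hx' | hx'⟩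
    · exact hx'
    · exact ⟨(hS hx).1, hx'.2.trans hup⟩
  · intro x hx hc
    refine ⟨h.mem_of_comparable (Or.inl ⟨hx.1, hx.2.trans (hS hp).2⟩) fun y hy => ?_, Or.inl hx⟩
    rcases h.total hy hp with hyp | hyp
    · exact hc y ⟨hy, Or.inl ⟨(hS hy).1, hyp⟩⟩
    · exact Or.inl (hx.2.trans hyp)

theorem IsMaxChainBetween.truncate (h : IsMaxChainBetween u v S) (hp : p ∈ S) :
    IsMaxChainBetween u p (S ∩ (Icc u p ∪ Icc p u)) := by
  rcases h.total h.left_mem h.right_mem with huv | huv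
  · exact h.truncate_of_le huv hp
  · rw [← isMaxChainBetween_toDual] at h ⊢
    have := h.truncate_of_le huv (p := OrderDual.toDual p) hp
    rw [union_comm]
    simpa only [Set.Icc_toDual, ← preimage_union, ← preimage_inter] using this

theorem IsMaxChainBetween.union_of_le (h : IsMaxChainBetween u p S) (h' : IsMaxChainBetween p v T)
    (hup : u ≤ p) (hpv : p ≤ v) : IsMaxChainBetween u v (S ∪ T) := by
  have hS := h.subset_Icc hup
  have hT := h'.subset_Icc hpv
  refine isMaxChainBetween_of_le (hup.trans hpv) ?_ (Or.inl h.left_mem) (Or.inr h'.right_mem)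
    ?_ ?_
  · rintro x (hx | hx) y (hy | hy) hne
    · exact h.total hx hy
    · exact Or.inl ((hS hx).2.trans (hT hy).1)
    · exact Or.inr ((hS hy).2.trans (hT hx).1)
    · exact h'.total hx hy
  · rintro x (hx | hx)
    · exact ⟨(hS hx).1, (hS hx).2.trans hpv⟩
    · exact ⟨hup.trans (hT hx).1, (hT hx).2⟩
  · intro x hx hc
    rcases hc p (Or.inl h.right_mem) with hxp | hxp
    · exact Or.inl (h.mem_of_comparable (Or.inl ⟨hx.1, hxp⟩) fun y hy => hc y (Or.inl hy))
    · exact Or.inr (h'.mem_of_comparable (Or.inl ⟨hxp, hx.2⟩) fun y hy => hc y (Or.inr hy))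

end Chains

/-- Nonempty sets bounded below have an infimum and nonempty sets bounded above a supremum. -/
def IsConditionallyComplete (P : Type*) [PartialOrder P] : Prop :=
  (∀ S : Set P, S.Nonempty → BddBelow S → ∃ x, IsGLB S x) ∧
    ∀ S : Set P, S.Nonempty → BddAbove S → ∃ x, IsLUB S x

theorem IsConditionallyComplete.dual {P : Type*} [PartialOrder P]
    (h : IsConditionallyComplete P) : IsConditionallyComplete Pᵒᵈ :=
  ⟨fun S => h.2 S, fun S => h.1 S⟩

/-! ### The first point of a chain in an interval -/

section FirstPoint

variable {P : Type*} [PartialOrder P] {u v a c : P} {S : Set P}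

/-- The first point is the infimum of `S ∩ Icc a c`. It is comparable with every point of `S`, so
maximality puts it in `S`. -/
theorem IsMaxChainBetween.exists_first_of_le (hP : IsConditionallyComplete P)
    (h : IsMaxChainBetween u v S) (huv : u ≤ v) (hne : (S ∩ Icc a c).Nonempty) :
    ∃ p ∈ S ∩ Icc a c, S ∩ (Icc u p ∪ Icc p u) ∩ Icc a c ⊆ {p} := by
  have hS := h.subset_Icc huv
  obtain ⟨p, hp⟩ := hP.1 _ hne ⟨u, fun x hx => (hS hx.1).1⟩
  obtain ⟨y, hy⟩ := hne
  have hup : u ≤ p := hp.2 fun x hx => (hS hx.1).1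
  have hpS : p ∈ S := by
    refine h.mem_of_comparable (Or.inl ⟨hup, (hp.1 hy).trans (hS hy.1).2⟩) fun x hx => ?_
    by_cases hx' : x ∈ lowerBounds (S ∩ Icc a c)
    · exact Or.inr (hp.2 hx')
    · simp only [mem_lowerBounds, not_forall] at hx'
      obtain ⟨w, hw, hxw⟩ := hx'
      exact Or.inl ((hp.1 hw).trans ((h.total hx hw.1).resolve_left hxw))
  refine ⟨p, ⟨hpS, hp.2 fun x hx => hx.2.1, (hp.1 hy).trans hy.2.2⟩, ?_⟩
  rintro x ⟨⟨hx, hxp⟩, hx'⟩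
  refine le_antisymm ?_ (hp.1 ⟨hx, hx'⟩)
  rcases hxp with hxp | hxp
  · exact hxp.2
  · exact hxp.2.trans hup

theorem IsMaxChainBetween.exists_first (hP : IsConditionallyComplete P)
    (h : IsMaxChainBetween u v S) (hne : (S ∩ Icc a c).Nonempty) :
    ∃ p ∈ S ∩ Icc a c, S ∩ (Icc u p ∪ Icc p u) ∩ Icc a c ⊆ {p} := by
  rcases h.total h.left_mem h.right_mem with huv | huv
  · exact h.exists_first_of_le hP huv hne
  · rw [← isMaxChainBetween_toDual] at h
    have := h.exists_first_of_le hP.dual huv (a := OrderDual.toDual c) (c := OrderDual.toDual a)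
      (by
        obtain ⟨y, hy, hy'⟩ := hne
        exact ⟨OrderDual.toDual y, hy, hy'.2, hy'.1⟩)
    obtain ⟨p, ⟨hp, hp'⟩, hsub⟩ := this
    refine ⟨OrderDual.ofDual p, ⟨hp, hp'.2, hp'.1⟩, ?_⟩
    rintro x ⟨⟨hx, hxp⟩, hx'⟩
    exact hsub ⟨⟨hx, hxp.symm.imp And.symm And.symm⟩, hx'.2, hx'.1⟩

end FirstPoint

/-- `y` lies strictly above `x` (direction `true`) or strictly below it (direction `false`). -/
def IsStep {P : Type*} [PartialOrder P] : Bool → P → P → Prop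
  | true, x, y => x < y
  | false, x, y => y < x

section Step

variable {P : Type*} [PartialOrder P] {b : Bool} {x y z u v p : P} {S T : Set P}

theorem IsStep.ne (h : IsStep b x y) : x ≠ y := by
  cases b
  · exact ne_of_gt h
  · exact ne_of_lt h

theorem IsStep.trans (h : IsStep b x y) (h' : IsStep b y z) : IsStep b x z := by
  cases b
  · exact lt_trans h' h
  · exact lt_trans h h'

theorem IsStep.asymm (h : IsStep b x y) : ¬ IsStep b y x := fun h' => (h.trans h').ne rfl

theorem isStep_not : IsStep (!b) x y ↔ IsStep b y x := by
  cases b <;> rfl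

theorem IsStep.le_or_le (h : IsStep b x y) : x ≤ y ∨ y ≤ x := by
  cases b
  · exact Or.inr (le_of_lt h)
  · exact Or.inl (le_of_lt h)

theorem exists_isStep (h : x ≤ y ∨ y ≤ x) (hne : x ≠ y) : ∃ b, IsStep b x y := by
  rcases h with h | h
  · exact ⟨true, lt_of_le_of_ne h hne⟩
  · exact ⟨false, lt_of_le_of_ne h hne.symm⟩

theorem IsStep.union (h : IsStep b u p) (h' : IsStep b p v) (hS : IsMaxChainBetween u p S)
    (hT : IsMaxChainBetween p v T) : IsMaxChainBetween u v (S ∪ T) := by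
  cases b
  · rw [isMaxChainBetween_comm] at hS hT ⊢
    rw [union_comm]
    exact hT.union_of_le hS (le_of_lt h') (le_of_lt h)
  · exact hS.union_of_le hT (le_of_lt h) (le_of_lt h')

theorem IsStep.of_mem (h : IsStep b u v) (hS : IsMaxChainBetween u v S) (hx : x ∈ S)
    (hne : x ≠ u) : IsStep b u x := by
  cases b
  · exact lt_of_le_of_ne ((isMaxChainBetween_comm.1 hS).subset_Icc (le_of_lt h) hx).2 hne
  · exact lt_of_le_of_ne (hS.subset_Icc (le_of_lt h) hx).1 hne.symm

theorem IsStep.of_mem_right (h : IsStep b u v) (hS : IsMaxChainBetween u v S) (hx : x ∈ S)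
    (hne : x ≠ v) : IsStep b x v := by
  cases b
  · exact lt_of_le_of_ne ((isMaxChainBetween_comm.1 hS).subset_Icc (le_of_lt h) hx).1 hne.symm
  · exact lt_of_le_of_ne (hS.subset_Icc (le_of_lt h) hx).2 hne

end Step

/-- `A` is the point set of a path from `r` to `z` made of `n` links of alternating directions,
the last of which has direction `b`.  The trivial path `{r}` counts for both directions. -/
inductive RootPath {P : Type*} [PartialOrder P] (r : P) : ℕ → Bool → Set P → P → Prop
  | nil (b : Bool) : RootPath r 0 b {r} r
  | snoc {n : ℕ} {b : Bool} {A S : Set P} {z w : P} (hA : RootPath r n (!b) A z)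
      (hstep : IsStep b z w) (hS : IsMaxChainBetween z w S) (hdisj : A ∩ S ⊆ {z}) :
      RootPath r (n + 1) b (A ∪ S) w

/-! ### Operations on alternating paths from a root -/

namespace RootPath

variable {P : Type*} [PartialOrder P] {r z w p a c x y t : P} {n m : ℕ} {b d : Bool}
  {A B S : Set P}

theorem root_mem (h : RootPath r n b A z) : r ∈ A := by
  induction h with
  | nil b => rfl
  | snoc _ _ _ _ ih => exact Or.inl ih

theorem end_mem (h : RootPath r n b A z) : z ∈ A := by
  cases h with
  | nil b => rfl
  | snoc _ _ hS _ => exact Or.inr hS.right_mem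

theorem eq_of_zero (h : RootPath r 0 b A z) : z = r ∧ A = {r} := by
  cases h
  exact ⟨rfl, rfl⟩

/-- A new link with the direction of the last one would break alternation, so the two are merged and
the number of links stays `n`. -/
theorem append (h : RootPath r n d B p) (hstep : IsStep b p w) (hS : IsMaxChainBetween p w S)
    (hdisj : B ∩ S ⊆ {p}) :
    (RootPath r (n + 1) b (B ∪ S) w ∧ RootPath r n (!b) B p) ∨
      (RootPath r n b (B ∪ S) w ∧ d = b ∧ n ≠ 0) := by
  by_cases hd : d = !b
  · subst hd
    exact Or.inl ⟨.snoc h hstep hS hdisj, h⟩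
  have hd : d = b := by simpa using hd
  subst hd
  cases h with
  | nil => exact Or.inl ⟨.snoc (.nil _) hstep hS hdisj, .nil _⟩
  | @snoc n _ A T z _ hA hzp hT hAT =>
    refine Or.inr ⟨?_, rfl, by simp⟩
    rw [union_assoc]
    refine .snoc hA (hzp.trans hstep) (hzp.union hstep hT hS) ?_
    rintro x ⟨hxA, hx | hx⟩
    · exact hAT ⟨hxA, hx⟩
    · have hxp : x = p := hdisj ⟨Or.inl hxA, hx⟩
      subst hxp
      exact hAT ⟨hxA, hT.right_mem⟩

theorem truncate (hA : RootPath r n (!b) A z) (hstep : IsStep b z w)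
    (hS : IsMaxChainBetween z w S) (hdisj : A ∩ S ⊆ {z}) (hp : p ∈ S) (hpz : p ≠ z) :
    RootPath r (n + 1) b (A ∪ (S ∩ (Icc z p ∪ Icc p z))) p :=
  .snoc hA (hstep.of_mem hS hp hpz) (hS.truncate hp)
    ((inter_subset_inter_right _ inter_subset_left).trans hdisj)

/-- By induction, only the first link that meets the interval is cut. The last clause says that a
proper initial segment misses the endpoint; it yields antisymmetry of the tree order. -/
theorem first_hit (hP : IsConditionallyComplete P) (h : RootPath r n b A z)
    (hne : (A ∩ Icc a c).Nonempty) :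
    ∃ p m d B, RootPath r m d B p ∧ B ⊆ A ∧ B ∩ Icc a c = {p} ∧ (z ∈ B → p = z) := by
  induction h with
  | nil b =>
    obtain ⟨x, rfl, hx⟩ := hne
    exact ⟨x, 0, b, {x}, .nil b, subset_rfl, by simpa using hx, fun _ => rfl⟩
  | @snoc n b A S z w hA hstep hS hdisj ih =>
    by_cases hA' : (A ∩ Icc a c).Nonempty
    · obtain ⟨p, m, d, B, hB, hBA, hBp, -⟩ := ih hA'
      refine ⟨p, m, d, B, hB, hBA.trans subset_union_left, hBp, fun hw => ?_⟩
      exact absurd (hdisj ⟨hBA hw, hS.right_mem⟩ : w = z).symm hstep.ne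
    · have hS' : (S ∩ Icc a c).Nonempty := by
        obtain ⟨x, hx | hx, hx'⟩ := hne
        · exact absurd ⟨x, hx, hx'⟩ hA'
        · exact ⟨x, hx, hx'⟩
      obtain ⟨p, ⟨hpS, hp⟩, hsub⟩ := hS.exists_first hP hS'
      have hpz : p ≠ z := by
        rintro rfl
        exact hA' ⟨p, hA.end_mem, hp⟩
      have hpath := truncate hA hstep hS hdisj hpS hpz
      refine ⟨p, _, _, _, hpath, union_subset_union_right _ inter_subset_left, ?_, ?_⟩
      · refine Subset.antisymm ?_ (singleton_subset_iff.2 ⟨hpath.end_mem, hp⟩)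
        rintro x ⟨hx | hx, hx'⟩
        · exact absurd ⟨x, hx, hx'⟩ hA'
        · exact hsub ⟨hx, hx'⟩
      · rintro (hw | ⟨-, hw⟩)
        · exact absurd (hdisj ⟨hw, hS.right_mem⟩ : w = z).symm hstep.ne
        · by_contra hpw
          have h1 := hstep.of_mem_right hS hpS hpw
          have h2 := hstep.of_mem hS hpS hpz
          cases b
          · rcases hw with hw | hw
            · exact lt_irrefl _ (lt_of_lt_of_le hstep hw.1)
            · exact lt_irrefl _ (lt_of_lt_of_le h1 hw.1)
          · rcases hw with hw | hw
            · exact lt_irrefl _ (lt_of_le_of_lt hw.2 h1)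
            · exact lt_irrefl _ (lt_of_le_of_lt hw.2 hstep)

theorem linear (h : RootPath r n b A z) (hx : x ∈ A) (hy : y ∈ A) :
    (∃ m d B, RootPath r m d B y ∧ x ∈ B) ∨ ∃ m d B, RootPath r m d B x ∧ y ∈ B := by
  induction h with
  | nil b =>
    cases hx
    cases hy
    exact Or.inl ⟨_, _, _, .nil true, rfl⟩
  | @snoc n b A S z w hA hstep hS hdisj ih =>
    by_cases hxA : x ∈ A
    · by_cases hyA : y ∈ A
      · exact ih hxA hyA
      · have hyz : y ≠ z := fun h => hyA (h ▸ hA.end_mem)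
        exact Or.inl ⟨_, _, _, truncate hA hstep hS hdisj (hy.resolve_left hyA) hyz, Or.inl hxA⟩
    · have hxz : x ≠ z := fun h => hxA (h ▸ hA.end_mem)
      have hxS := hx.resolve_left hxA
      have hpx := truncate hA hstep hS hdisj hxS hxz
      by_cases hyA : y ∈ A
      · exact Or.inr ⟨_, _, _, hpx, Or.inl hyA⟩
      · have hyz : y ≠ z := fun h => hyA (h ▸ hA.end_mem)
        have hyS := hy.resolve_left hyA
        have hpy := truncate hA hstep hS hdisj hyS hyz
        have h1 := hstep.of_mem hS hxS hxz
        have h2 := hstep.of_mem hS hyS hyz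
        rcases hS.total hxS hyS with hxy | hxy <;> cases b
        · exact Or.inr ⟨_, _, _, hpx, Or.inr ⟨hyS, Or.inr ⟨hxy, le_of_lt h2⟩⟩⟩
        · exact Or.inl ⟨_, _, _, hpy, Or.inr ⟨hxS, Or.inl ⟨le_of_lt h1, hxy⟩⟩⟩
        · exact Or.inl ⟨_, _, _, hpy, Or.inr ⟨hxS, Or.inr ⟨hxy, le_of_lt h1⟩⟩⟩
        · exact Or.inr ⟨_, _, _, hpx, Or.inr ⟨hyS, Or.inl ⟨le_of_lt h2, hxy⟩⟩⟩

end RootPath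

/-- A set `M` of points of a conditionally complete order and a root `r ∈ M`, such that any two
paths from `r` to a point of `M` agree and every turning point of such a path belongs to `M`. -/
structure IsRootedCycleFree {P : Type*} [PartialOrder P] (M : Set P) (r : P) : Prop where
  complete : IsConditionallyComplete P
  root_mem : r ∈ M
  unique : ∀ {t : P} {n m : ℕ} {b d : Bool} {A B : Set P}, t ∈ M → RootPath r n b A t →
    RootPath r m d B t → A = B
  turning_mem : ∀ {t z : P} {n : ℕ} {b : Bool} {A S : Set P}, t ∈ M → RootPath r n (!b) A z →
    IsStep b z t → IsMaxChainBetween z t S → A ∩ S ⊆ {z} → z ∈ M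

/-- `t` is reached from `r` by a path whose last link has direction `b`. -/
def ArrivesBy {P : Type*} [PartialOrder P] (r : P) (b : Bool) (t : P) : Prop :=
  ∃ n A, RootPath r n b A t

/-- `s` lies on a path from `r` to `t`. -/
def OnRootPath {P : Type*} [PartialOrder P] (r s t : P) : Prop :=
  ∃ n b A, RootPath r n b A t ∧ s ∈ A

/-! ### Continuing a path inside an interval -/

namespace RootPath

variable {P : Type*} [PartialOrder P] {r z w p a c x y s t : P} {n m : ℕ} {b d : Bool}
  {A B S : Set P}

/-- A chain from `p` to `x` stays in the interval, where `B` has no point but `p`, so disjointness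
is automatic. -/
theorem extend (h : RootPath r n d B p) (hp : B ∩ Icc a c = {p}) (hx : x ∈ Icc a c)
    (hstep : IsStep b p x) (hS : IsMaxChainBetween p x S) :
    (RootPath r (n + 1) b (B ∪ S) x ∧ RootPath r n (!b) B p) ∨
      (RootPath r n b (B ∪ S) x ∧ d = b ∧ n ≠ 0) := by
  refine h.append hstep hS ?_
  have hpm : p ∈ Icc a c := (hp.symm.subset rfl : p ∈ B ∩ Icc a c).2
  rw [← hp]
  refine inter_subset_inter_right _ (hS.subset.trans (union_subset ?_ ?_))
  · exact Icc_subset_Icc hpm.1 hx.2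
  · exact Icc_subset_Icc hx.1 hpm.2

theorem arrivesBy (h : RootPath r n d B p) (hp : B ∩ Icc a c = {p}) (hx : x ∈ Icc a c)
    (hstep : IsStep b p x) : ArrivesBy r b x := by
  obtain ⟨S, hS⟩ := exists_isMaxChainBetween hstep.le_or_le
  rcases h.extend hp hx hstep hS with h | h
  · exact ⟨_, _, h.1⟩
  · exact ⟨_, _, h.1⟩

theorem exists_of_comparable (hP : IsConditionallyComplete P) (h : RootPath r n b A s)
    (hst : s ≤ t ∨ t ≤ s) : ∃ d, ArrivesBy r d t := by
  obtain ⟨a, c, hs, ht, hcomp⟩ : ∃ a c, s ∈ Icc a c ∧ t ∈ Icc a c ∧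
      ∀ p ∈ Icc a c, p ≤ t ∨ t ≤ p := by
    rcases hst with hst | hst
    · exact ⟨s, t, ⟨le_rfl, hst⟩, ⟨hst, le_rfl⟩, fun p hp => Or.inl hp.2⟩
    · exact ⟨t, s, ⟨hst, le_rfl⟩, ⟨le_rfl, hst⟩, fun p hp => Or.inr hp.1⟩
  obtain ⟨p, m, d, B, hB, -, hp, -⟩ := h.first_hit hP ⟨s, h.end_mem, hs⟩
  have hpm : p ∈ Icc a c := (hp.symm.subset rfl : p ∈ B ∩ Icc a c).2
  by_cases hpt : p = t
  · subst hpt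
    exact ⟨d, m, B, hB⟩
  obtain ⟨e, he⟩ := exists_isStep (hcomp p hpm) hpt
  exact ⟨e, hB.arrivesBy hp ht he⟩

end RootPath

/-! ### Consequences of uniqueness of root paths -/

namespace IsRootedCycleFree

variable {P : Type*} [PartialOrder P] {M : Set P} {r z w p a c x y s t u : P} {n m : ℕ}
  {b d : Bool} {A B S : Set P}

/-- Stopping `A` at the degenerate interval `[s, s]` gives a path to `s` inside `A`, which is `B` by
uniqueness. -/
theorem subset_of_mem (h : IsRootedCycleFree M r) (hs : s ∈ M) (hA : RootPath r n b A t)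
    (hB : RootPath r m d B s) (hsA : s ∈ A) : B ⊆ A ∧ (t ∈ B → s = t) := by
  obtain ⟨p, m', d', B', hB', hBA, hp, hend⟩ := hA.first_hit (a := s) (c := s) h.complete
    ⟨s, hsA, le_rfl, le_rfl⟩
  have hps : p = s := by
    have hpm : p ∈ Icc s s := (hp.symm.subset rfl : p ∈ B' ∩ Icc s s).2
    exact le_antisymm hpm.2 hpm.1
  subst hps
  rw [h.unique hs hB hB']
  exact ⟨hBA, hend⟩

theorem mem_of_onRootPath (h : IsRootedCycleFree M r) (ht : t ∈ M) (hst : OnRootPath r s t)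
    (hA : RootPath r n b A t) : s ∈ A := by
  obtain ⟨m, d, B, hB, hs⟩ := hst
  rwa [h.unique ht hA hB]

theorem onRootPath_trans (h : IsRootedCycleFree M r) (ht : t ∈ M)
    (hst : OnRootPath r s t) (htu : OnRootPath r t u) : OnRootPath r s u := by
  obtain ⟨n, b, A, hA, hs⟩ := hst
  obtain ⟨m, d, B, hB, ht'⟩ := htu
  exact ⟨m, d, B, hB, (h.subset_of_mem ht hB hA ht').1 hs⟩

theorem onRootPath_antisymm (h : IsRootedCycleFree M r) (hs : s ∈ M)
    (hst : OnRootPath r s t) (hts : OnRootPath r t s) : s = t := by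
  obtain ⟨n, b, A, hA, hs'⟩ := hst
  obtain ⟨m, d, B, hB, ht'⟩ := hts
  exact (h.subset_of_mem hs hA hB hs').2 ht'

theorem onRootPath_total (h : IsRootedCycleFree M r) (ht : t ∈ M)
    (hx : OnRootPath r x t) (hy : OnRootPath r y t) : OnRootPath r x y ∨ OnRootPath r y x := by
  obtain ⟨n, b, A, hA, hx'⟩ := hx
  have hy' := h.mem_of_onRootPath ht hy hA
  rcases hA.linear hx' hy' with ⟨m, d, B, hB⟩ | ⟨m, d, B, hB⟩
  · exact Or.inl ⟨m, d, B, hB⟩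
  · exact Or.inr ⟨m, d, B, hB⟩

/-- A path never visits points beyond its endpoint in its last direction. Otherwise, stopping it at
the first point `p` between `t` and `a` and returning from `p` to `t` gives a second path to `t`. By
uniqueness this contains the last turning point `z`, which lies before `t`; but `z` would have to be
`p` or lie on the return link, hence beyond `t`. -/
theorem not_isStep_of_mem (h : IsRootedCycleFree M r) (ht : t ∈ M)
    (hA : RootPath r (n + 1) b A t) (ha : a ∈ A) : ¬ IsStep b t a := by
  intro hta
  have hA' := hA
  cases hA with
  | @snoc _ _ A S z _ hA hstep hS hdisj =>
    have haA : a ∈ A := by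
      refine ha.resolve_right fun haS => ?_
      exact hta.asymm (hstep.of_mem_right hS haS hta.ne.symm)
    obtain ⟨u, v, huv, ht', ha'⟩ : ∃ u v, (∀ x ∈ Icc u v, x = t ∨ IsStep b t x) ∧
        t ∈ Icc u v ∧ a ∈ Icc u v := by
      cases b
      · exact ⟨a, t, fun x hx => hx.2.eq_or_lt, ⟨le_of_lt hta, le_rfl⟩, ⟨le_rfl, le_of_lt hta⟩⟩
      · exact ⟨t, a, fun x hx => hx.1.eq_or_lt.imp Eq.symm id, ⟨le_rfl, le_of_lt hta⟩,
          ⟨le_of_lt hta, le_rfl⟩⟩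
    obtain ⟨p, m, d, B, hB, hBA, hp, hend⟩ := hA.first_hit h.complete ⟨a, haA, ha'⟩
    have hpm : p ∈ B ∩ Icc u v := hp.symm.subset rfl
    have hpt : p ≠ t := by
      rintro rfl
      exact hstep.ne (hdisj ⟨hBA hpm.1, hS.right_mem⟩ : p = z).symm
    have htp := (huv p hpm.2).resolve_left hpt
    have hpt' : IsStep (!b) p t := isStep_not.2 htp
    obtain ⟨T, hT⟩ := exists_isMaxChainBetween hpt'.le_or_le
    have key : A ∪ S = B ∪ T := by
      rcases hB.extend hp ht' hpt' hT with h' | h'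
      · exact h.unique ht hA' h'.1
      · exact h.unique ht hA' h'.1
    have hz : z ∈ B ∪ T := key ▸ Or.inl hA.end_mem
    rcases hz with hz | hz
    · exact htp.asymm (hend hz ▸ hstep)
    · exact (isStep_not.1 (hpt'.of_mem_right hT hz hstep.ne)).asymm hstep

/-- The last links have the same direction and the same starting point, since otherwise
`not_isStep_of_mem` fails at `t` or at one of the starting points. Induction then applies at the
common starting point, which is in `M` as a turning point. The trivial path is exempt because it
carries both directions. -/
theorem level_unique (h : IsRootedCycleFree M r) (ht : t ∈ M) (hA : RootPath r n b A t)
    (hB : RootPath r m d B t) : n = m ∧ (n ≠ 0 → b = d) := by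
  induction hA generalizing m d B with
  | nil b =>
    have hBr := h.unique ht (.nil true) hB
    cases hB with
    | nil => simp
    | @snoc _ _ B S z _ hB hstep hS hdisj =>
      have : z ∈ ({r} : Set P) := hBr ▸ Or.inl hB.end_mem
      exact absurd this hstep.ne
  | @snoc n b A S z w hA hstep hS hdisj ih =>
    have hA' := RootPath.snoc hA hstep hS hdisj
    have hz := h.turning_mem ht hA hstep hS hdisj
    have key := h.unique ht hA' hB
    have hB' := hB
    cases hB with
    | nil =>
      have : z ∈ ({r} : Set P) := key ▸ Or.inl hA.end_mem
      exact absurd this hstep.ne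
    | @snoc m d B T z' _ hB hstep' hT hdisj' =>
      have hz' := h.turning_mem ht hB hstep' hT hdisj'
      have hzB : z ∈ B ∪ T := key ▸ Or.inl hA.end_mem
      have hz'A : z' ∈ A ∪ S := key ▸ Or.inl hB.end_mem
      have hbd : b = d := by
        by_contra hbd
        have hbd : d = !b := by cases b <;> cases d <;> simp_all
        subst hbd
        exact h.not_isStep_of_mem ht hA' hz'A (isStep_not.1 hstep')
      subst hbd
      have hzz : z = z' := by
        by_contra hne
        rcases hz'A with hz'A | hz'S
        · have hsub := h.subset_of_mem hz' hA hB hz'A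
          rcases hzB with hzB | hzT
          · exact hne (hsub.2 hzB).symm
          · have hzz := hstep'.of_mem hT hzT hne
            cases hA with
            | nil =>
              exact hne (mem_singleton_iff.1 hz'A).symm
            | snoc hA1 hstep1 hS1 hdisj1 =>
              exact h.not_isStep_of_mem hz (.snoc hA1 hstep1 hS1 hdisj1) hz'A (isStep_not.2 hzz)
        · have hzz := hstep.of_mem hS hz'S (Ne.symm hne)
          have hzB : z ∈ B := by
            refine hzB.resolve_right fun hzT => ?_
            exact hzz.asymm (hstep'.of_mem hT hzT hne)
          cases hB with
          | nil => exact hne hzB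
          | snoc hB1 hstep1 hS1 hdisj1 =>
            exact h.not_isStep_of_mem hz' (.snoc hB1 hstep1 hS1 hdisj1) hzB (isStep_not.2 hzz)
      subst hzz
      refine ⟨?_, fun _ => rfl⟩
      rw [(ih hz hB).1]

theorem eq_root_of_arrivesBy (h : IsRootedCycleFree M r) (ht : t ∈ M) (h1 : ArrivesBy r b t)
    (h2 : ArrivesBy r (!b) t) : t = r := by
  obtain ⟨n, A, hA⟩ := h1
  obtain ⟨m, B, hB⟩ := h2
  have := h.level_unique ht hA hB
  cases n with
  | zero => exact hA.eq_of_zero.1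
  | succ n => simpa using this.2

theorem onRootPath_root (h : IsRootedCycleFree M r) (ht : OnRootPath r t r) : t = r :=
  mem_singleton_iff.1 (h.mem_of_onRootPath h.root_mem ht (.nil true))

/-- If `z` came before the last link, the turning point `w` opening that link would be reached in
both directions, hence be `r`, and then `z = r = w`. So `z` lies on the last link. -/
theorem isStep_of_arrivesBy (h : IsRootedCycleFree M r) (ht : t ∈ M) (hzt : OnRootPath r z t)
    (hb : ∀ u ∈ M, OnRootPath r z u → u ≠ z → OnRootPath r u t → ArrivesBy r b u) :
    z = t ∨ IsStep b z t := by
  by_cases hne : t = z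
  · exact Or.inl hne.symm
  obtain ⟨n, d, A, hA, hzA⟩ := hzt
  have htb := hb t ht ⟨n, d, A, hA, hzA⟩ hne ⟨n, d, A, hA, hA.end_mem⟩
  cases hA with
  | nil => exact Or.inl hzA
  | @snoc n d A S w _ hA hstep hS hdisj =>
    have hA' := RootPath.snoc hA hstep hS hdisj
    have hdb : b = d := by
      obtain ⟨k, B, hB⟩ := htb
      exact ((h.level_unique ht hA' hB).2 (by simp)).symm
    subst hdb
    by_cases hzS : z ∈ S
    · exact Or.inr (hstep.of_mem_right hS hzS (Ne.symm hne))
    have hzA := hzA.resolve_right hzS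
    have hw := h.turning_mem ht hA hstep hS hdisj
    have hzw : OnRootPath r z w := ⟨_, _, _, hA, hzA⟩
    have hwz : w ≠ z := fun h => hzS (h ▸ hS.left_mem)
    have hwb := hb w hw hzw hwz ⟨_, _, _, hA', Or.inl hA.end_mem⟩
    have hwr := h.eq_root_of_arrivesBy hw hwb ⟨_, _, hA⟩
    subst hwr
    exact absurd (h.onRootPath_root hzw).symm hwz

theorem arrivesBy_of_between (h : IsRootedCycleFree M r) (hx : x ∈ M)
    (hB : RootPath r n d B p) (hp : B ∩ Icc a c = {p}) (hxm : x ∈ Icc a c)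
    (hstep : IsStep b p x) :
    OnRootPath r p x ∧ ∀ u ∈ M, OnRootPath r p u → u ≠ p → OnRootPath r u x → ArrivesBy r b u := by
  obtain ⟨S, hS⟩ := exists_isMaxChainBetween hstep.le_or_le
  have hpm : p ∈ Icc a c := (hp.symm.subset rfl : p ∈ B ∩ Icc a c).2
  obtain ⟨k, hk⟩ : ∃ k, RootPath r k b (B ∪ S) x := by
    rcases hB.extend hp hxm hstep hS with h' | h'
    · exact ⟨_, h'.1⟩
    · exact ⟨_, h'.1⟩
  refine ⟨⟨_, _, _, hk, Or.inl hB.end_mem⟩, fun u hu hpu hne hux => ?_⟩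
  have huS : u ∈ S := by
    refine (h.mem_of_onRootPath hx hux hk).resolve_left fun huB => ?_
    exact hne (h.onRootPath_antisymm hu ⟨_, _, _, hB, huB⟩ hpu)
  refine hB.arrivesBy hp ?_ (hstep.of_mem hS huS hne)
  rcases hS.subset huS with h' | h'
  · exact Icc_subset_Icc hpm.1 hxm.2 h'
  · exact Icc_subset_Icc hxm.1 hpm.2 h'

/-- The witness `z` is the first point of the path to `s` in `[s, t]`; from there the paths to `s`
and `t` run monotonically inside the interval. -/
theorem le_iff (h : IsRootedCycleFree M r) (hs : s ∈ M) (ht : t ∈ M) (hsr : ∃ b, ArrivesBy r b s) :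
    s ≤ t ↔ ∃ z ∈ M, OnRootPath r z s ∧ OnRootPath r z t ∧
      (∀ u ∈ M, OnRootPath r z u → u ≠ z → OnRootPath r u s → ArrivesBy r false u) ∧
      ∀ u ∈ M, OnRootPath r z u → u ≠ z → OnRootPath r u t → ArrivesBy r true u := by
  constructor
  · intro hst
    obtain ⟨b, n, A, hA⟩ := hsr
    obtain ⟨p, m, d, B, hB, hBA, hp, -⟩ := hA.first_hit (a := s) (c := t) h.complete
      ⟨s, hA.end_mem, le_rfl, hst⟩
    have hpm : p ∈ Icc s t := (hp.symm.subset rfl : p ∈ B ∩ Icc s t).2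
    have hsm : s ∈ Icc s t := ⟨le_rfl, hst⟩
    have htm : t ∈ Icc s t := ⟨hst, le_rfl⟩
    have hpM : p ∈ M := by
      by_cases hps : p = s
      · exact hps ▸ hs
      by_cases hpt : p = t
      · exact hpt ▸ ht
      have h1 : IsStep false p s := lt_of_le_of_ne hpm.1 (Ne.symm hps)
      have h2 : IsStep true p t := lt_of_le_of_ne hpm.2 hpt
      -- If `p` is neither `s` nor `t`, one of these lies in the direction opposite to the arrival
      -- at `p`, so the path to it turns at `p`.
      have hturn : ∀ {e x}, x ∈ M → x ∈ Icc s t → IsStep e p x → d = !e → p ∈ M := by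
        rintro e x hx hxm hstep rfl
        obtain ⟨S, hS⟩ := exists_isMaxChainBetween hstep.le_or_le
        refine h.turning_mem hx hB hstep hS ?_
        rw [← hp]
        exact inter_subset_inter_right _ (hS.subset.trans (union_subset
          (Icc_subset_Icc hpm.1 hxm.2) (Icc_subset_Icc hxm.1 hpm.2)))
      cases d
      · exact hturn ht htm h2 rfl
      · exact hturn hs hsm h1 rfl
    have trivial_case : ∀ {e : Bool}, ∀ u ∈ M, OnRootPath r p u → u ≠ p → OnRootPath r u p →
        ArrivesBy r e u := fun u hu h1 h2 h3 => absurd (h.onRootPath_antisymm hu h3 h1) h2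
    have hside : ∀ {e x}, x ∈ M → x ∈ Icc s t → (p = x ∨ IsStep e p x) → OnRootPath r p x ∧
        ∀ u ∈ M, OnRootPath r p u → u ≠ p → OnRootPath r u x → ArrivesBy r e u := by
      rintro e x hx hxm (rfl | hstep)
      · exact ⟨⟨_, _, _, hB, hB.end_mem⟩, trivial_case⟩
      · exact h.arrivesBy_of_between hx hB hp hxm hstep
    have hs' := hside (e := false) hs hsm (hpm.1.eq_or_lt.imp Eq.symm id)
    have ht' := hside (e := true) ht htm hpm.2.eq_or_lt
    exact ⟨p, hpM, hs'.1, ht'.1, hs'.2, ht'.2⟩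
  · rintro ⟨z, -, hzs, hzt, hs', ht'⟩
    have h1 : s ≤ z := by
      rcases h.isStep_of_arrivesBy hs hzs hs' with h' | h'
      · exact h'.ge
      · exact le_of_lt h'
    have h2 : z ≤ t := by
      rcases h.isStep_of_arrivesBy ht hzt ht' with h' | h'
      · exact h'.le
      · exact le_of_lt h'
    exact h1.trans h2

end IsRootedCycleFree

/-! ### Completeness of the completion and the action of automorphisms -/

/-- Bounds are taken in the complete lattice of all cuts. One half stays nonempty thanks to the
given bound, the other thanks to an element of `S`. -/
theorem MDCompletion.isConditionallyComplete (M : Type*) [PartialOrder M] :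
    IsConditionallyComplete (MDCompletion M) := by
  constructor
  · rintro S ⟨s, hs⟩ ⟨a, ha⟩
    have hglb : IsGLB (Subtype.val '' S) (sInf (Subtype.val '' S) : DedekindCut M) :=
      isGLB_sInf _
    have h1 : a.1 ≤ sInf (Subtype.val '' S) := by
      refine hglb.2 ?_
      rintro _ ⟨x, hx, rfl⟩
      exact ha hx
    have h2 : sInf (Subtype.val '' S) ≤ s.1 := hglb.1 ⟨s, hs, rfl⟩
    refine ⟨⟨sInf (Subtype.val '' S), a.2.1.mono (Concept.extent_subset_extent_iff.2 h1),
      s.2.2.mono (Concept.intent_subset_intent_iff.2 h2)⟩, fun x hx => hglb.1 ⟨x, hx, rfl⟩,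
      fun x hx => hglb.2 (show x.1 ∈ lowerBounds (Subtype.val '' S) from ?_)⟩
    rintro _ ⟨y, hy, rfl⟩
    exact hx hy
  · rintro S ⟨s, hs⟩ ⟨a, ha⟩
    have hlub : IsLUB (Subtype.val '' S) (sSup (Subtype.val '' S) : DedekindCut M) :=
      isLUB_sSup _
    have h1 : sSup (Subtype.val '' S) ≤ a.1 := by
      refine hlub.2 ?_
      rintro _ ⟨x, hx, rfl⟩
      exact ha hx
    have h2 : s.1 ≤ sSup (Subtype.val '' S) := hlub.1 ⟨s, hs, rfl⟩
    refine ⟨⟨sSup (Subtype.val '' S), s.2.1.mono (Concept.extent_subset_extent_iff.2 h2),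
      a.2.2.mono (Concept.intent_subset_intent_iff.2 h1)⟩, fun x hx => hlub.1 ⟨x, hx, rfl⟩,
      fun x hx => hlub.2 (show x.1 ∈ upperBounds (Subtype.val '' S) from ?_)⟩
    rintro _ ⟨y, hy, rfl⟩
    exact hx hy

/-- The action of an automorphism of `M` on the completion of `M`. -/
def MDCompletion.congr {M : Type*} [PartialOrder M] (e : M ≃o M) :
    MDCompletion M ≃o MDCompletion M :=
  let pre (f : M ≃o M) (A : MDCompletion M) : MDCompletion M :=
    ⟨{  extent := f ⁻¹' A.1.left
        intent := f ⁻¹' A.1.right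
        upperPolar_extent := by
          rw [← A.1.upperBounds_left]
          ext x
          constructor
          · intro hx y hy
            have := hx (a := f.symm y) (by simpa using hy)
            simpa using f.monotone this
          · intro hx y hy
            exact f.le_iff_le.1 (hx hy)
        lowerPolar_intent := by
          rw [← A.1.lowerBounds_right]
          ext x
          constructor
          · intro hx y hy
            have := hx (b := f.symm y) (by simpa using hy)
            simpa using f.monotone this
          · intro hx y hy
            exact f.le_iff_le.1 (hx hy) },
      A.2.1.preimage f.surjective, A.2.2.preimage f.surjective⟩
  { toFun := pre e.symm
    invFun := pre e
    left_inv := fun A => Subtype.ext (DedekindCut.ext (by ext x; simp [pre, DedekindCut.left]))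
    right_inv := fun A => Subtype.ext (DedekindCut.ext (by ext x; simp [pre, DedekindCut.left]))
    map_rel_iff' := e.symm.surjective.preimage_subset_preimage_iff }

theorem MDCompletion.congr_toMD {M : Type*} [PartialOrder M] (e : M ≃o M) (x : M) :
    MDCompletion.congr e (toMD x) = toMD (e x) := by
  refine Subtype.ext (DedekindCut.ext ?_)
  ext y
  exact e.symm_apply_le

section Map

variable {P : Type*} [PartialOrder P]

theorem IsMaxChainBetween.image (φ : P ≃o P) {u v : P} {S : Set P}
    (h : IsMaxChainBetween u v S) : IsMaxChainBetween (φ u) (φ v) (φ '' S) := by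
  refine ⟨⟨?_, mem_image_of_mem _ h.left_mem, mem_image_of_mem _ h.right_mem, ?_⟩, ?_⟩
  · rintro _ ⟨x, hx, rfl⟩ _ ⟨y, hy, rfl⟩ -
    exact (h.total hx hy).imp (fun h => φ.monotone h) (fun h => φ.monotone h)
  · rintro _ ⟨x, hx, rfl⟩
    refine (h.subset hx).imp ?_ ?_ <;> rintro ⟨h1, h2⟩ <;>
      exact ⟨φ.monotone h1, φ.monotone h2⟩
  · rintro T ⟨h1, -, -, h4⟩ hST x hx
    refine ⟨φ.symm x, h.mem_of_comparable ?_ fun y hy => ?_, φ.apply_symm_apply x⟩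
    · refine (h4 hx).imp ?_ ?_ <;> rintro ⟨h1, h2⟩ <;>
        exact ⟨φ.le_symm_apply.2 h1, φ.symm_apply_le.2 h2⟩
    · exact (h1.total hx (hST (mem_image_of_mem _ hy))).imp φ.symm_apply_le.2 φ.le_symm_apply.2

theorem RootPath.image (φ : P ≃o P) {r z : P} {n : ℕ} {b : Bool} {A : Set P}
    (h : RootPath r n b A z) : RootPath (φ r) n b (φ '' A) (φ z) := by
  induction h with
  | nil b =>
    rw [image_singleton]
    exact .nil b
  | @snoc n b A S z w hA hstep hS hdisj ih =>
    rw [image_union]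
    refine .snoc ih ?_ (hS.image φ) ?_
    · cases b <;> exact φ.strictMono hstep
    · rw [← image_inter φ.injective, ← image_singleton]
      exact image_mono hdisj

theorem OnRootPath.image (φ : P ≃o P) {r s t : P} (hr : φ r = r) (h : OnRootPath r s t) :
    OnRootPath r (φ s) (φ t) := by
  obtain ⟨n, b, A, hA, hs⟩ := h
  exact ⟨n, b, _, by simpa only [hr] using hA.image φ, mem_image_of_mem _ hs⟩

end Map

/-- `c 0, …, c n` are the turning points and `S 0, …, S (n - 1)` the links of a path from `r` to
`z` with point set `A` and last direction `b`. -/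
structure IsLinkSequence {P : Type*} [PartialOrder P] (r : P) (n : ℕ) (b : Bool) (A : Set P)
    (z : P) (c : ℕ → P) (S : ℕ → Set P) : Prop where
  first : c 0 = r
  last : c n = z
  chain : ∀ k < n, IsMaxChainBetween (c k) (c (k + 1)) (S k)
  alternating : ∀ k, k + 1 < n → ∃ d, IsStep d (c k) (c (k + 1)) ∧
    IsStep (!d) (c (k + 1)) (c (k + 2))
  last_step : ∀ k, k + 1 = n → IsStep b (c k) (c (k + 1))
  disjoint : ∀ i j, i < j → j < n → ∀ x ∈ S i, x ∈ S j → j = i + 1 ∧ x = c (i + 1)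
  mem_iff : ∀ x, x ∈ A ↔ x = r ∨ ∃ k < n, x ∈ S k

/-! ### From inductive paths to indexed turning points -/

section LinkSequence

variable {P : Type*} [PartialOrder P] {r z w : P} {n : ℕ} {b : Bool} {A T : Set P} {c : ℕ → P}
  {S : ℕ → Set P}

theorem IsLinkSequence.snoc (h : IsLinkSequence r n (!b) A z c S) (hstep : IsStep b z w)
    (hT : IsMaxChainBetween z w T) (hdisj : A ∩ T ⊆ {z}) :
    IsLinkSequence r (n + 1) b (A ∪ T) w (fun k => if k ≤ n then c k else w)
      (fun k => if k < n then S k else T) where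
  first := by simp [h.first]
  last := by simp
  chain k hk := by
    rcases Nat.lt_succ_iff_lt_or_eq.1 hk with hk | rfl
    · simpa [hk, hk.le, Nat.succ_le_iff.2 hk] using h.chain k hk
    · simpa [h.last] using hT
  alternating k hk := by
    rcases Nat.lt_succ_iff_lt_or_eq.1 hk with hk | rfl
    · have h1 : k ≤ n := by omega
      have h2 : k + 1 ≤ n := by omega
      have h3 : k + 2 ≤ n := by omega
      simpa [h1, h2, h3] using h.alternating k hk
    · refine ⟨!b, ?_, ?_⟩
      · simpa using h.last_step k rfl
      · simpa [h.last] using hstep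
  last_step k hk := by
    obtain rfl : k = n := by omega
    simpa [h.last] using hstep
  disjoint i j hij hj x hxi hxj := by
    have hi : i < n := by omega
    have hi' : i + 1 ≤ n := hi
    simp only [hi, if_true] at hxi
    rcases Nat.lt_succ_iff_lt_or_eq.1 hj with hj | rfl
    · simp only [hj, if_true] at hxj
      simpa [hi'] using h.disjoint i j hij hj x hxi hxj
    · simp only [lt_irrefl, if_false] at hxj
      have hxz : x = z := hdisj ⟨(h.mem_iff x).2 (Or.inr ⟨i, hi, hxi⟩), hxj⟩
      subst hxz
      -- Otherwise `z`, the end of the link `S k` before the new one, also lies on an earlier link,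
      -- so it equals the start of `S k`, contradicting strictness of that step.
      have hji : j = i + 1 := by
        by_contra hne
        obtain ⟨k, rfl⟩ : ∃ k, j = k + 1 := ⟨j - 1, by omega⟩
        have hxk : x ∈ S k := by
          have := (h.chain k (by omega)).right_mem
          rwa [h.last] at this
        obtain ⟨h1, h2⟩ := h.disjoint i k (by omega) (by omega) x hxi hxk
        subst h1
        have := (h.last_step (i + 1) rfl).ne
        rw [h.last] at this
        exact this h2.symm
      subst hji
      simpa using h.last.symm
  mem_iff x := by
    rw [mem_union, h.mem_iff x, or_assoc]
    refine or_congr_right ⟨?_, ?_⟩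
    · rintro (⟨k, hk, hx⟩ | hx)
      · exact ⟨k, by omega, by simpa [hk] using hx⟩
      · exact ⟨n, by omega, by simpa using hx⟩
    · rintro ⟨k, hk, hx⟩
      by_cases hk' : k < n
      · exact Or.inl ⟨k, hk', by simpa [hk'] using hx⟩
      · exact Or.inr (by simpa [hk'] using hx)

theorem RootPath.exists_isLinkSequence (h : RootPath r n b A z) :
    ∃ c S, IsLinkSequence r n b A z c S := by
  induction h with
  | nil b =>
    exact ⟨fun _ => r, fun _ => ∅, rfl, rfl, by simp, by simp, by simp, by simp, by simp⟩
  | snoc hA hstep hS hdisj ih =>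
    obtain ⟨c, S, h⟩ := ih
    exact ⟨_, _, h.snoc hstep hS hdisj⟩

end LinkSequence

/-! ### Root paths as paths of the order -/

section Paths

variable {M : Type*} [PartialOrder M] {r t : M} {n : ℕ} {b : Bool} {A : Set (MDCompletion M)}

theorem IsLinkSequence.isPathVia {c : ℕ → MDCompletion M} {S : ℕ → Set (MDCompletion M)}
    (h : IsLinkSequence (toMD r) (n + 1) b A (toMD t) c S) :
    IsPathVia r t (n + 1) (fun k => c k) A := by
  refine ⟨⟨by omega, by simpa using h.first, by simpa using h.last, ?_, ?_⟩,
    fun k => S k, ?_, ?_, ?_⟩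
  · intro k
    have := h.chain k k.2
    simpa using this.total this.left_mem this.right_mem
  · rintro ⟨i, hi⟩ ⟨j, hj⟩ hij
    simp only at hij
    subst hij
    obtain ⟨d, h1, h2⟩ := h.alternating i (by omega)
    cases d
    · exact Or.inr ⟨h1, h2⟩
    · exact Or.inl ⟨h1, h2⟩
  · intro k
    simpa using h.chain k k.2
  · rintro i j hij x ⟨hxi, hxj⟩
    simpa using h.disjoint i j hij j.2 x hxi hxj
  · ext x
    rw [h.mem_iff, mem_iUnion]
    constructor
    · rintro (rfl | ⟨k, hk, hx⟩)
      · refine ⟨0, ?_⟩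
        have := (h.chain 0 (by omega)).left_mem
        rwa [h.first] at this
      · exact ⟨⟨k, hk⟩, hx⟩
    · rintro ⟨k, hx⟩
      exact Or.inr ⟨k, k.2, hx⟩

theorem RootPath.isPath (h : RootPath (toMD r) n b A (toMD t)) : IsPath r t A := by
  cases n with
  | succ n =>
    obtain ⟨c, S, hc⟩ := h.exists_isLinkSequence
    exact ⟨_, _, hc.isPathVia⟩
  | zero =>
    obtain ⟨htr, rfl⟩ := h.eq_of_zero
    -- A connecting set has at least two terms, so the trivial path is presented by `r, r` with the
    -- single chain `{r}`.
    refine ⟨1, fun _ => toMD r, ⟨⟨le_rfl, rfl, htr.symm, fun _ => Or.inl le_rfl, ?_⟩,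
      fun _ => {toMD r}, ?_, ?_, by simp⟩⟩
    · intro i j hij
      omega
    · intro k
      exact isMaxChainBetween_of_le le_rfl subsingleton_singleton.isChain rfl rfl (by simp)
        (by simp)
    · intro i j hij
      omega

theorem isRootedCycleFree_range (hcf : IsCFPO M) (hturn : TurningPointsIn r) :
    IsRootedCycleFree (range (toMD : M → MDCompletion M)) (toMD r) where
  complete := MDCompletion.isConditionallyComplete M
  root_mem := ⟨r, rfl⟩
  unique := by
    rintro _ n m b d A B ⟨t, rfl⟩ hA hB
    exact hcf r t A B hA.isPath hB.isPath
  turning_mem := by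
    rintro _ z n b A S ⟨t, rfl⟩ hA hstep hS hdisj
    obtain ⟨c, T, hc⟩ := hA.exists_isLinkSequence
    have h := hturn t _ _ _ (hc.snoc hstep hS hdisj).isPathVia ⟨n, by omega⟩
    simpa [hc.last] using h

/-- Being reachable by a root path passes between comparable points, so it spreads along any
connecting set. -/
theorem exists_arrivesBy (hcf : IsCFPO M) (hconn : IsPathConnectedOrder M)
    (hturn : TurningPointsIn r) (t : M) : ∃ b, ArrivesBy (toMD r) b (toMD t) := by
  have h := isRootedCycleFree_range hcf hturn
  obtain ⟨P, n, c, hc⟩ := hconn r t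
  have key : ∀ k : Fin (n + 1), ∃ b, ArrivesBy (toMD r) b (c k) := by
    intro k
    induction k using Fin.induction with
    | zero =>
      rw [hc.1.first]
      exact ⟨true, 0, _, .nil _⟩
    | succ i ih =>
      obtain ⟨b, m, A, hA⟩ := ih
      exact hA.exists_of_comparable h.complete (hc.1.comparable i)
  simpa [hc.1.last] using key (Fin.last n)

end Paths

namespace IsRootedCycleFree

variable {P : Type*} [PartialOrder P] {M : Set P} {r t y : P} {n : ℕ} {b : Bool} {A : Set P}

/-- The path to `y` enters the interval between `y` and `t` at some `p`, reached by at most `n`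
links because `p` can be continued to `y`. Going on to `t` costs at most one more link. -/
theorem exists_rootPath_of_isStep (h : IsRootedCycleFree M r) (hy : y ∈ M)
    (hA : RootPath r n (!b) A y) (hstep : IsStep b y t) :
    ∃ k d B, RootPath r k d B t ∧ ((k = n + 1 ∧ d = b) ∨ k ≤ n) := by
  obtain ⟨a, c, hym, htm, hcomp⟩ : ∃ a c, y ∈ Icc a c ∧ t ∈ Icc a c ∧
      ∀ p ∈ Icc a c, (p = y ∨ IsStep (!b) p y) ∧ (p = t ∨ IsStep b p t) := by
    cases b
    · exact ⟨t, y, ⟨le_of_lt hstep, le_rfl⟩, ⟨le_rfl, le_of_lt hstep⟩,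
        fun p hp => ⟨hp.2.eq_or_lt, hp.1.eq_or_lt.imp Eq.symm id⟩⟩
    · exact ⟨y, t, ⟨le_rfl, le_of_lt hstep⟩, ⟨le_of_lt hstep, le_rfl⟩,
        fun p hp => ⟨hp.1.eq_or_lt.imp Eq.symm id, hp.2.eq_or_lt⟩⟩
  obtain ⟨p, m, d, B, hB, -, hp, -⟩ := hA.first_hit h.complete ⟨y, hA.end_mem, hym⟩
  have hpm : p ∈ Icc a c := (hp.symm.subset rfl : p ∈ B ∩ Icc a c).2
  obtain ⟨hpy, hpt⟩ := hcomp p hpm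
  have hmn : m ≤ n := by
    rcases hpy with rfl | hpy
    · exact (h.level_unique hy hB hA).1.le
    · obtain ⟨S, hS⟩ := exists_isMaxChainBetween hpy.le_or_le
      rcases hB.extend hp hym hpy hS with h' | h'
      · have := (h.level_unique hy h'.1 hA).1
        omega
      · exact (h.level_unique hy h'.1 hA).1.le
  rcases hpt with rfl | hpt
  · exact ⟨m, d, B, hB, Or.inr hmn⟩
  · obtain ⟨S, hS⟩ := exists_isMaxChainBetween hpt.le_or_le
    rcases hB.extend hp htm hpt hS with h' | h'
    · refine ⟨_, _, _, h'.1, ?_⟩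
      rcases hmn.eq_or_lt with rfl | hlt
      · exact Or.inl ⟨rfl, rfl⟩
      · exact Or.inr hlt
    · exact ⟨_, _, _, h'.1, Or.inr hmn⟩

end IsRootedCycleFree

theorem RootPath.exists_one_iff {P : Type*} [PartialOrder P] {r t : P} {b : Bool} :
    (∃ A, RootPath r 1 b A t) ↔ IsStep b r t := by
  constructor
  · rintro ⟨A, hA⟩
    cases hA with
    | snoc hA hstep _ _ =>
      rw [hA.eq_of_zero.1] at hstep
      exact hstep
  · intro h
    obtain ⟨S, hS⟩ := exists_isMaxChainBetween h.le_or_le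
    exact ⟨_, .snoc (.nil _) h hS inter_subset_left⟩

/-- The layers `X_n` (direction `true`) and `Y_n` (direction `false`). -/
def layerOf {M : Type*} [PartialOrder M] (r : M) : Bool → ℕ → Set M
  | true => layerX r
  | false => layerY r

/-! ### Layers and numbers of links -/

section Layers

variable {M : Type*} [PartialOrder M] {r : M}

theorem isStep_toMD {b : Bool} {x y : M} : IsStep b (toMD x) (toMD y) ↔ IsStep b x y := by
  cases b <;> simp [IsStep, lt_iff_le_not_ge, toMD_le_toMD]

theorem toMD_injective : Function.Injective (toMD : M → MDCompletion M) := fun _ _ h =>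
  le_antisymm (toMD_le_toMD.1 h.le) (toMD_le_toMD.1 h.ge)

theorem mem_layerOf_succ {b : Bool} {n : ℕ} {t : M} :
    t ∈ layerOf r b (n + 1) ↔ (∃ y ∈ layerOf r (!b) n, IsStep b y t) ∧
      t ∉ ⋃ i < n + 1, layerX r i ∪ layerY r i := by
  cases b
  · simp only [layerOf, layerY_succ]
    exact Iff.rfl
  · simp only [layerOf, layerX_succ]
    constructor
    · rintro ⟨⟨y, hy, hyt⟩, ht⟩
      refine ⟨⟨y, hy, lt_of_le_of_ne hyt ?_⟩, ht⟩
      rintro rfl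
      exact ht (mem_biUnion (Nat.lt_succ_self n) (Or.inr hy))
    · rintro ⟨⟨y, hy, hyt⟩, ht⟩
      exact ⟨⟨y, hy, le_of_lt hyt⟩, ht⟩

/-- Layer `n` consists of the points at `n + 1` links; `r`, with no link, is added to `X_0`. The
removed union is the set of points reached with fewer links, which `level_unique` keeps apart from
the new layer. -/
theorem mem_layerOf_iff (h : IsRootedCycleFree (range (toMD : M → MDCompletion M)) (toMD r))
    (n : ℕ) : ∀ (b : Bool) (t : M), t ∈ layerOf r b n ↔
      (∃ A, RootPath (toMD r) (n + 1) b A (toMD t)) ∨ (n = 0 ∧ b = true ∧ t = r) := by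
  induction n using Nat.strong_induction_on with
  | _ n ih =>
  intro b t
  cases n with
  | zero =>
    rw [zero_add, RootPath.exists_one_iff, isStep_toMD]
    cases b
    · simp [layerOf, layerY_zero, IsStep]
    · simp [layerOf, layerX_zero, IsStep, le_iff_lt_or_eq, eq_comm]
  | succ n =>
    have hunion : t ∈ ⋃ i < n + 1, layerX r i ∪ layerY r i ↔
        ∃ k d B, RootPath (toMD r) k d B (toMD t) ∧ k ≤ n + 1 := by
      simp only [mem_iUnion, exists_prop]
      constructor
      · rintro ⟨i, hi, ht⟩
        obtain ⟨d, hd⟩ : ∃ d, t ∈ layerOf r d i := by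
          rcases ht with ht | ht
          · exact ⟨true, ht⟩
          · exact ⟨false, ht⟩
        rcases (ih i hi d t).1 hd with ⟨B, hB⟩ | ⟨-, -, rfl⟩
        · exact ⟨_, _, _, hB, hi⟩
        · exact ⟨0, true, _, .nil _, by omega⟩
      · rintro ⟨k, d, B, hB, hk⟩
        cases k with
        | zero =>
          exact ⟨0, by omega, Or.inl ((ih 0 (by omega) true t).2
            (Or.inr ⟨rfl, rfl, toMD_injective hB.eq_of_zero.1⟩))⟩
        | succ k =>
          have := (ih k (by omega) d t).2 (Or.inl ⟨B, hB⟩)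
          refine ⟨k, by omega, ?_⟩
          cases d
          · exact Or.inr this
          · exact Or.inl this
    rw [mem_layerOf_succ, hunion]
    constructor
    · rintro ⟨⟨y, hy, hyt⟩, ht⟩
      obtain ⟨j, A, hA, hj⟩ : ∃ j A, RootPath (toMD r) j (!b) A (toMD y) ∧ j ≤ n + 1 := by
        rcases (ih n (by omega) _ y).1 hy with ⟨A, hA⟩ | ⟨-, -, rfl⟩
        · exact ⟨_, _, hA, le_rfl⟩
        · exact ⟨0, _, .nil _, by omega⟩
      obtain ⟨k, d, B, hB, hk⟩ := h.exists_rootPath_of_isStep ⟨y, rfl⟩ hA (isStep_toMD.2 hyt)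
      have hnk : ¬ k ≤ n + 1 := fun hk => ht ⟨k, d, B, hB, hk⟩
      rcases hk with ⟨rfl, rfl⟩ | hk
      · obtain rfl : j = n + 1 := by omega
        exact Or.inl ⟨B, hB⟩
      · omega
    · rintro (⟨A, hA⟩ | ⟨h0, -⟩)
      · refine ⟨?_, ?_⟩
        · cases hA with
          | snoc hA hstep hS hdisj =>
            obtain ⟨y, rfl⟩ := h.turning_mem ⟨t, rfl⟩ hA hstep hS hdisj
            exact ⟨y, (ih n (by omega) _ y).2 (Or.inl ⟨_, hA⟩), isStep_toMD.1 hstep⟩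
        · rintro ⟨k, d, B, hB, hk⟩
          have := (h.level_unique ⟨t, rfl⟩ hA hB).1
          omega
      · omega

theorem mem_iUnion_layerX_iff
    (h : IsRootedCycleFree (range (toMD : M → MDCompletion M)) (toMD r)) {t : M} :
    t ∈ ⋃ n, layerX r n ↔ ArrivesBy (toMD r) true (toMD t) := by
  rw [mem_iUnion]
  constructor
  · rintro ⟨n, hn⟩
    rcases (mem_layerOf_iff h n true t).1 hn with ⟨A, hA⟩ | ⟨-, -, rfl⟩
    · exact ⟨_, _, hA⟩
    · exact ⟨0, _, .nil _⟩
  · rintro ⟨n, A, hA⟩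
    cases n with
    | zero => exact ⟨0, (mem_layerOf_iff h 0 true t).2
        (Or.inr ⟨rfl, rfl, toMD_injective hA.eq_of_zero.1⟩)⟩
    | succ n => exact ⟨n, (mem_layerOf_iff h n true t).2 (Or.inl ⟨A, hA⟩)⟩

end Layers

/-! ### The tree and its automorphisms -/

section Tree

variable {M ι : Type*} [PartialOrder M] {C : ι → Set M} {r : M}

theorem treeOf_le_iff (hcf : IsCFPO M) (hconn : IsPathConnectedOrder M)
    (hturn : TurningPointsIn r) {s t : M} :
    (treeOf C r).le s t ↔ OnRootPath (toMD r) (toMD s) (toMD t) := by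
  constructor
  · rintro ⟨P, hP, hs⟩
    obtain ⟨b, n, A, hA⟩ := exists_arrivesBy hcf hconn hturn t
    exact ⟨n, b, A, hA, hcf r t P A hP hA.isPath ▸ hs⟩
  · rintro ⟨n, b, A, hA, hs⟩
    exact ⟨A, hA.isPath, hs⟩

theorem treeOf_isTree (hcf : IsCFPO M) (hconn : IsPathConnectedOrder M)
    (hturn : TurningPointsIn r) : (treeOf C r).IsTree := by
  have h := isRootedCycleFree_range hcf hturn
  have hex := exists_arrivesBy hcf hconn hturn
  constructor <;> simp only [treeOf_le_iff hcf hconn hturn]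
  · intro x
    obtain ⟨b, n, A, hA⟩ := hex x
    exact ⟨n, b, A, hA, hA.end_mem⟩
  · intro x y z hxy hyz
    exact h.onRootPath_trans ⟨y, rfl⟩ hxy hyz
  · intro x y hxy hyx
    exact toMD_injective (h.onRootPath_antisymm ⟨x, rfl⟩ hxy hyx)
  · intro t x y hx hy
    exact h.onRootPath_total ⟨t, rfl⟩ hx hy
  · intro x y
    obtain ⟨b, n, A, hA⟩ := hex x
    obtain ⟨d, m, B, hB⟩ := hex y
    exact ⟨r, ⟨n, b, A, hA, hA.root_mem⟩, ⟨m, d, B, hB, hB.root_mem⟩⟩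

theorem le_iff_treeOf (hcf : IsCFPO M) (hconn : IsPathConnectedOrder M)
    (hturn : TurningPointsIn r) {s t : M} :
    s ≤ t ↔ ∃ z, (treeOf C r).le z s ∧ (treeOf C r).le z t ∧
      (∀ u, (treeOf C r).le z u → u ≠ z → (treeOf C r).le u s → u ∉ (treeOf C r).colour none) ∧
      ∀ u, (treeOf C r).le z u → u ≠ z → (treeOf C r).le u t → u ∈ (treeOf C r).colour none := by
  have h := isRootedCycleFree_range hcf hturn
  have hex := exists_arrivesBy hcf hconn hturn
  have hU : ∀ u, u ∈ (treeOf C r).colour none ↔ ArrivesBy (toMD r) true (toMD u) :=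
    fun u => mem_iUnion_layerX_iff h
  -- Such a `u` is not `r`, since only `r` lies on the path to `r`; hence it has exactly one arrival
  -- direction.
  have hU' : ∀ z u : M, OnRootPath (toMD r) (toMD z) (toMD u) → u ≠ z →
      (¬ ArrivesBy (toMD r) true (toMD u) ↔ ArrivesBy (toMD r) false (toMD u)) := by
    intro z u hzu hne
    constructor
    · intro hu
      obtain ⟨b, hb⟩ := hex u
      cases b
      · exact hb
      · exact absurd hb hu
    · intro h1 h2
      have hur := toMD_injective (h.eq_root_of_arrivesBy ⟨u, rfl⟩ h2 h1)
      subst hur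
      exact hne (toMD_injective (h.onRootPath_root hzu)).symm
  rw [← toMD_le_toMD, h.le_iff ⟨s, rfl⟩ ⟨t, rfl⟩ (hex s)]
  simp only [treeOf_le_iff hcf hconn hturn, hU, exists_range_iff, forall_mem_range,
    toMD_injective.ne_iff]
  refine exists_congr fun z => and_congr_right' (and_congr_right' (and_congr_left' ?_))
  exact forall_congr' fun u => forall_congr' fun hzu => forall_congr' fun hne =>
    imp_congr_right fun _ => (hU' z u hzu hne).symm

theorem aut_colouredOrder_le_aut_treeOf (hcf : IsCFPO M) (hconn : IsPathConnectedOrder M)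
    (hr : ∀ g ∈ (colouredOrder C).Aut, g r = r) (hturn : TurningPointsIn r) :
    (colouredOrder C).Aut ≤ (treeOf C r).Aut := by
  have h := isRootedCycleFree_range hcf hturn
  have key : ∀ g ∈ (colouredOrder C).Aut,
      (∀ x y, (treeOf C r).le x y → (treeOf C r).le (g x) (g y)) ∧
        ∀ x, x ∈ (treeOf C r).colour none → g x ∈ (treeOf C r).colour none := by
    intro g hg
    let e : M ≃o M := ⟨g, fun {x y} => hg.1 x y⟩
    have he : MDCompletion.congr e (toMD r) = toMD r := by
      rw [MDCompletion.congr_toMD]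
      exact congrArg toMD (hr g hg)
    refine ⟨fun x y hxy => ?_, fun x hx => ?_⟩
    · rw [treeOf_le_iff hcf hconn hturn] at hxy ⊢
      have := hxy.image (MDCompletion.congr e) he
      rwa [MDCompletion.congr_toMD, MDCompletion.congr_toMD] at this
    · obtain ⟨n, A, hA⟩ := (mem_iUnion_layerX_iff h).1 hx
      have := hA.image (MDCompletion.congr e)
      rw [he, MDCompletion.congr_toMD] at this
      exact (mem_iUnion_layerX_iff h).2 ⟨n, _, this⟩
  intro g hg
  have hinv := key g⁻¹ (inv_mem hg)
  refine ⟨fun x y => ⟨fun hxy => ?_, (key g hg).1 x y⟩, ?_⟩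
  · simpa using hinv.1 _ _ hxy
  · rintro (_ | i) x
    · exact ⟨fun hx => by simpa using hinv.2 _ hx, (key g hg).2 x⟩
    · exact hg.2 i x

theorem aut_treeOf_le_aut_colouredOrder (hcf : IsCFPO M) (hconn : IsPathConnectedOrder M)
    (hturn : TurningPointsIn r) : (treeOf C r).Aut ≤ (colouredOrder C).Aut := by
  have key : ∀ g ∈ (treeOf C r).Aut, ∀ x y : M, x ≤ y → g x ≤ g y := by
    intro g hg x y hxy
    rw [le_iff_treeOf (C := C) hcf hconn hturn] at hxy ⊢
    obtain ⟨z, h1, h2, h3, h4⟩ := hxy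
    refine ⟨g z, (hg.1 _ _).2 h1, (hg.1 _ _).2 h2, ?_, ?_⟩ <;>
      refine g.surjective.forall.2 fun u => ?_ <;>
      rw [hg.1, hg.1, hg.2, g.injective.ne_iff]
    · exact h3 u
    · exact h4 u
  intro g hg
  refine ⟨fun x y => ⟨fun hxy => ?_, key g hg x y⟩, fun i => hg.2 (some i)⟩
  have : x ≤ y := by simpa using key g⁻¹ (inv_mem hg) _ _ hxy
  exact this

end Tree

theorem mainTheorem1 {M : Type*} [PartialOrder M] {ι : Type*} (C : ι → Set M)
    (hcf : IsCFPO M) (hconn : IsPathConnectedOrder M)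
    (r : M) (hr : ∀ g ∈ (colouredOrder C).Aut, g r = r)
    (hturn : TurningPointsIn r) :
    (treeOf C r).IsTree ∧ PermGroupIso (colouredOrder C).Aut (treeOf C r).Aut :=
  ⟨treeOf_isTree hcf hconn hturn,
    MulEquiv.subgroupCongr (le_antisymm (aut_colouredOrder_le_aut_treeOf hcf hconn hr hturn)
      (aut_treeOf_le_aut_colouredOrder hcf hconn hturn)), Equiv.refl M, fun _ _ => rfl⟩
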